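/- Let $S$ and $A$ be finite sets and let $P\colon S\times A\times S\to[0,1]$ be such that $\sum_{s'}P(s,a,s')\in\{0,1\}$ for all $s\in S$, $a\in A$ (a finite Markov decision process). Let $A(s)=\{a:\sum_{s'}P(s,a,s')=1\}$ be the set of actions enabled in $s$, assume $A(s)\neq\emptyset$ for all $s$, and put $\mathrm{Post}(s,a)=\{s':P(s,a,s')>0\}$. Let $T\subseteq S$ be a target set, $\rho\colon S\to[0,\infty)$ a reward function, $\mathrm{opt}\in\{\min,\max\}$, and let $\overline{\mathrm{opt}}$ be the other element of $\{\min,\max\}$. A strategy is a map $\sigma\colon S\to A$ with $\sigma(s)\in A(s)$ for all $s$; it induces a Markov chain on $S$ with transition probabilities $P(s,\sigma(s),s')$. Let $\mathbb E^\sigma_s(\lozenge T)\in[0,\infty]$ be the expectation, over the infinite paths $s_0s_1\ldots$ of this chain started in $s_0=s$, of the random variable that equals $\sum_{k=0}^{\min\{i\,:\,s_i\in T\}}\rho(s_k)$ if some $s_i\in T$, and $\infty$ otherwise. Put $\mathbb E^{\mathrm{opt}}_s(\lozenge T)=\mathrm{opt}_\sigma\,\mathbb E^\sigma_s(\lozenge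 T)$. For $x\in[0,\infty]^S$ define $\mathcal E^{\mathrm{opt}}(x)(s)=0$ if $s\in T$, and $\mathcal E^{\mathrm{opt}}(x)(s)=\rho(s)+\mathrm{opt}_{a\in A(s)}\sum_{s'\in\mathrm{Post}(s,a)}P(s,a,s')\,x(s')$ if $s\notin T$. For $r\in(\mathbb N\cup\{\infty\})^S$ define $\tilde{\mathcal D}^{\mathrm{opt}}(r)(s)=\infty$ if $s\in T$, and $$\tilde{\mathcal D}^{\mathrm{opt}}(r)(s)=\mathrm{opt}_{a\in A(s)}\Big(\min_{s'\in\mathrm{Post}(s,a)}r(s')+\big[\exists u,v\in\mathrm{Post}(s,a)\colon r(u)\neq r(v)\big]\Big)\quad\text{if } s\notin T,$$ where $[\varphi]$ is $1$ if $\varphi$ holds and $0$ otherwise. Suppose that $(x,r)\in[0,\infty]^S\times(\mathbb N\cup\{\infty\})^S$ satisfies (with pointwise order) 1) $\tilde{\mathcal D}^{\overline{\mathrm{opt}}}(r)\le r$, 2) $x\le\mathcal E^{\mathrm{opt}}(x)$, and 3) for all $s\in S$, $x(s)=\infty$ implies $r(s)<\infty$. Then $\mathbb E^{\mathrm{opt}}_s(\lozenge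 T)\ge x(s)$ for all $s\in S$. -/

import Mathlib

open scoped NNReal ENNReal
open MeasureTheory ProbabilityTheory

noncomputable section

/-- The optimization direction `opt ∈ {min, max}`. -/
inductive Opt where
  | min
  | max

/-- The opposite direction. -/
def Opt.dual : Opt → Opt
  | .min => .max
  | .max => .min

/-- `opt_{i} f i`. It is only applied to nonempty finite families (enabled actions, strategies),
for which infimum and supremum are minimum and maximum. -/
def Opt.over {ι L : Type*} [CompleteLattice L] (opt : Opt) (f : ι → L) : L :=
  match opt with
  | .min => ⨅ i, f i
  | .max => ⨆ i, f i

/-- A Markov decision process with finite state set `S` and finite action set `A`: an action is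
enabled in a state if its outgoing probabilities sum to `1`, otherwise they sum to `0`, and every
state has an enabled action. -/
structure MDP (S A : Type*) [Fintype S] [Fintype A] where
  prob : S → A → S → ℝ≥0
  sum_prob : ∀ s a, ∑ s', prob s a s' = 0 ∨ ∑ s', prob s a s' = 1
  exists_enabled : ∀ s, ∃ a, ∑ s', prob s a s' = 1

namespace MDP

variable {S A : Type*} [Fintype S] [Fintype A]

/-- The enabled actions `Act(s)`. -/
def enabled (M : MDP S A) (s : S) : Set A := {a | ∑ s', M.prob s a s' = 1}

open Classical in
/-- The `a`-successors of `s`. -/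
def post (M : MDP S A) (s : S) (a : A) : Finset S := {s' | 0 < M.prob s a s'}

/-- Memoryless deterministic strategies. -/
def Strategy (M : MDP S A) : Type _ := {σ : S → A // ∀ s, σ s ∈ M.enabled s}

/-- The successor distribution of `s` in the Markov chain induced by the strategy `σ`. -/
def inducedStep (M : MDP S A) (σ : M.Strategy) (s : S) : PMF S :=
  PMF.ofFintype (fun s' => (M.prob s (σ.1 s) s' : ℝ≥0∞)) (by
    have h : ∑ s', M.prob s (σ.1 s) s' = 1 := σ.2 s
    exact_mod_cast h)

section Paths

variable [MeasurableSpace S] [DiscreteMeasurableSpace S]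

/-- The one-step kernel of the induced Markov chain, on histories `s₀ … sₙ`: the next state is
drawn from the successor distribution of the last state `sₙ`. -/
def stepKernel (M : MDP S A) (σ : M.Strategy) (n : ℕ) :
    Kernel ((_ : Finset.Iic n) → S) S where
  toFun h := (M.inducedStep σ (h ⟨n, Finset.mem_Iic.2 le_rfl⟩)).toMeasure
  measurable' := (measurable_of_countable (fun s : S => (M.inducedStep σ s).toMeasure)).comp
    (measurable_pi_apply _)

instance (M : MDP S A) (σ : M.Strategy) (n : ℕ) : IsMarkovKernel (M.stepKernel σ n) :=
  ⟨fun h => PMF.toMeasure.isProbabilityMeasure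
    (M.inducedStep σ (h ⟨n, Finset.mem_Iic.2 le_rfl⟩))⟩

/-- The probability measure on infinite paths of the Markov chain induced by `σ`, started in `s`
(Ionescu-Tulcea). -/
def pathMeasure (M : MDP S A) (σ : M.Strategy) (s : S) : Measure (ℕ → S) :=
  Kernel.traj (X := fun _ : ℕ => S) (M.stepKernel σ) 0 (fun _ => s)

end Paths

open Classical in
/-- The reward collected along an infinite path up to and including the first visit to `T`;
paths that never visit `T` receive `∞`. -/
def pathReward (T : Set S) (rew : S → ℝ≥0) (ω : ℕ → S) : ℝ≥0∞ :=
  if ∃ i, ω i ∈ T then ∑ k ∈ Finset.range (sInf {i | ω i ∈ T} + 1), (rew (ω k) : ℝ≥0∞) else ∞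

section Expectation

variable [MeasurableSpace S] [DiscreteMeasurableSpace S]

/-- The expected reward from `s` to `T` in the Markov chain induced by `σ`. -/
def expReward (M : MDP S A) (T : Set S) (rew : S → ℝ≥0) (σ : M.Strategy) (s : S) : ℝ≥0∞ :=
  ∫⁻ ω, pathReward T rew ω ∂(M.pathMeasure σ s)

/-- The optimal expected reward from `s` to `T`. -/
def optExpReward (M : MDP S A) (T : Set S) (rew : S → ℝ≥0) (opt : Opt) (s : S) : ℝ≥0∞ :=
  opt.over fun σ : M.Strategy => M.expReward T rew σ s

end Expectation

open Classical in
/-- The complementary distance operator. -/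
def compDist (M : MDP S A) (T : Set S) (opt : Opt) (r : S → ℕ∞) (s : S) : ℕ∞ :=
  if s ∈ T then ⊤
  else opt.over fun a : M.enabled s =>
    (⨅ s' ∈ M.post s a, r s') +
      (if ∃ u ∈ M.post s a, ∃ v ∈ M.post s a, r u ≠ r v then 1 else 0)

open Classical in
/-- The Bellman operator for expected rewards. -/
def bellmanReward (M : MDP S A) (T : Set S) (rew : S → ℝ≥0) (opt : Opt)
    (x : S → ℝ≥0∞) (s : S) : ℝ≥0∞ :=
  if s ∈ T then 0
  else (rew s : ℝ≥0∞) + opt.over fun a : M.enabled s =>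
    ∑ s' ∈ M.post s a, (M.prob s a s' : ℝ≥0∞) * x s'

/-- Valid certificates for lower bounds on `opt`-expected rewards. -/
structure IsLowerRewardCertificate (M : MDP S A) (T : Set S) (rew : S → ℝ≥0) (opt : Opt)
    (x : S → ℝ≥0∞) (r : S → ℕ∞) : Prop where
  rank : M.compDist T opt.dual r ≤ r
  value : x ≤ M.bellmanReward T rew opt x
  finite_rank : ∀ s, x s = ∞ → r s < ⊤

end MDP

end

/-! Fix a strategy; a chain with infinite expected reward needs no argument. Otherwise `T` is
reached almost surely, so the probability of avoiding `T` for `n` steps tends to 0. Let `p` be a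
lower bound on the positive transition probabilities. The rank condition makes `p ^ r` (0 at rank
`∞`, hence on `T`) a submartingale: either all successors share one rank, or one successor has
smaller rank and probability at least `p`. The expectation of `p ^ r` is therefore nondecreasing in
time, yet bounded by the vanishing avoidance probability, so it is 0: states of finite rank are
almost surely never visited (`ae_avoid_rank_eq_top`).

On the remaining states `x` is finite, hence bounded. Unfolding the value inequality `n` times
bounds `x s` by the reward collected before `T` plus a remainder that tends to 0 (`le_expReward`).
The two conditions are needed on disjoint sets of states, which lets a single strategy serve both
when maximizing. -/

open scoped NNReal ENNReal
open MeasureTheory ProbabilityTheory Filter Topology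

noncomputable section

namespace MDP

/-! ### Paths avoiding the target -/

section Paths

variable {S : Type*}

/-- The infinite paths that avoid `T` in the first `n + 1` states. -/
def avoid (T : Set S) (n : ℕ) : Set (ℕ → S) := {ω | ∀ i ≤ n, ω i ∉ T}

lemma avoid_anti (T : Set S) : Antitone (avoid T) :=
  fun _ _ hmn _ hω i hi => hω i (hi.trans hmn)

/-- Only an inequality: the left side omits the reward of the target state itself. -/
lemma sum_indicator_avoid_le_pathReward (T : Set S) (rew : S → ℝ≥0) (ω : ℕ → S) (n : ℕ) :
    ∑ k ∈ Finset.range n, (avoid T k).indicator (fun ω => (rew (ω k) : ℝ≥0∞)) ω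
      ≤ pathReward T rew ω := by
  classical
  unfold pathReward
  split_ifs with hT
  · set m := sInf {i | ω i ∈ T}
    have hm : ω m ∈ T := Nat.sInf_mem (s := {i | ω i ∈ T}) hT
    refine (Finset.sum_le_sum_of_ne_zero (t := Finset.range (m + 1)) fun k _ hk => ?_).trans
      (Finset.sum_le_sum fun k _ => Set.indicator_le_self _ _ _)
    have hk' : ω ∈ avoid T k := Set.mem_of_indicator_ne_zero hk
    by_contra hkm
    rw [Finset.mem_range, not_lt] at hkm
    exact hk' m (by omega) hm
  · exact le_top

variable [MeasurableSpace S] [DiscreteMeasurableSpace S]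

lemma measurableSet_avoid (T : Set S) (n : ℕ) : MeasurableSet (avoid T n) := by
  have : avoid T n = ⋂ i ∈ Set.Iic n, (fun ω : ℕ → S => ω i) ⁻¹' Tᶜ := by
    ext ω; simp [avoid]
  rw [this]
  exact MeasurableSet.biInter (Set.to_countable _) fun i _ =>
    measurable_pi_apply i (MeasurableSet.of_discrete)

lemma measurable_comp_eval (h : S → ℝ≥0∞) (n : ℕ) : Measurable fun ω : ℕ → S => h (ω n) :=
  (Measurable.of_discrete (f := h)).comp (measurable_pi_apply n)

end Paths

/-! ### One-step expectations and rank weights -/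

variable {S A : Type*} [Fintype S] [Fintype A]

/-- The expectation of `h` after playing the action `a` in the state `s`. -/
def stepExp (M : MDP S A) (h : S → ℝ≥0∞) (s : S) (a : A) : ℝ≥0∞ :=
  ∑ s' ∈ M.post s a, (M.prob s a s' : ℝ≥0∞) * h s'

lemma mem_post {M : MDP S A} {s s' : S} {a : A} : s' ∈ M.post s a ↔ 0 < M.prob s a s' := by
  simp [post]

lemma stepExp_eq_sum_univ (M : MDP S A) (h : S → ℝ≥0∞) (s : S) (a : A) :
    M.stepExp h s a = ∑ s', (M.prob s a s' : ℝ≥0∞) * h s' := by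
  refine Finset.sum_subset (Finset.subset_univ _) fun s' _ hs' => ?_
  rw [mem_post, not_lt, nonpos_iff_eq_zero] at hs'
  simp [hs']

lemma post_nonempty (M : MDP S A) {s : S} {a : A} (ha : a ∈ M.enabled s) :
    (M.post s a).Nonempty := by
  by_contra! hne
  have h0 : ∑ s', M.prob s a s' = 0 := Finset.sum_eq_zero fun s' _ => by
    have : s' ∉ M.post s a := by simp [hne]
    rwa [mem_post, not_lt, nonpos_iff_eq_zero] at this
  have h1 : ∑ s', M.prob s a s' = 1 := ha
  exact zero_ne_one (h0.symm.trans h1)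

lemma stepExp_const (M : MDP S A) {s : S} {a : A} (ha : a ∈ M.enabled s) (c : ℝ≥0∞) :
    M.stepExp (fun _ => c) s a = c := by
  have h1 : ∑ s', (M.prob s a s' : ℝ≥0∞) = 1 := by
    have : ∑ s', M.prob s a s' = 1 := ha
    exact_mod_cast this
  rw [stepExp_eq_sum_univ, ← Finset.sum_mul, h1, one_mul]

lemma stepExp_congr (M : MDP S A) {g h : S → ℝ≥0∞} {s : S} {a : A}
    (hgh : ∀ s' ∈ M.post s a, g s' = h s') : M.stepExp g s a = M.stepExp h s a :=
  Finset.sum_congr rfl fun s' hs' => by rw [hgh s' hs']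

/-- Positive transition probabilities of a finite MDP are bounded away from zero. -/
lemma exists_prob_lower_bound (M : MDP S A) :
    ∃ p : ℝ≥0∞, 0 < p ∧ p ≤ 1 ∧ ∀ s a, ∀ s' ∈ M.post s a, p ≤ M.prob s a s' := by
  classical
  -- Impossible transitions get the value 1, so that the finite infimum stays positive.
  let g : S × A × S → ℝ≥0∞ := fun t =>
    if 0 < M.prob t.1 t.2.1 t.2.2 then (M.prob t.1 t.2.1 t.2.2 : ℝ≥0∞) else 1
  refine ⟨min 1 (Finset.univ.inf g), lt_min one_pos ?_, min_le_left _ _, fun s a s' hs' => ?_⟩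
  · rw [Finset.lt_inf_iff ENNReal.zero_lt_top]
    intro t _
    by_cases ht : 0 < M.prob t.1 t.2.1 t.2.2
    · simpa only [g, if_pos ht, ENNReal.coe_pos] using ht
    · simp only [g, if_neg ht, one_pos]
  · refine (min_le_right _ _).trans ((Finset.inf_le (Finset.mem_univ (s, a, s'))).trans ?_)
    simp only [g, if_pos (mem_post.1 hs'), le_refl]

/-- The contribution of the action `a` to the complementary distance operator at `s`. -/
def rankBound (M : MDP S A) (r : S → ℕ∞) (s : S) (a : A) : ℕ∞ :=
  open Classical in
  (⨅ s' ∈ M.post s a, r s') +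
    (if ∃ u ∈ M.post s a, ∃ v ∈ M.post s a, r u ≠ r v then 1 else 0)

/-- The weight `p ^ n` of the rank `n`, which is `0` for the rank `∞`. -/
def rankWeight (p : ℝ≥0∞) (n : ℕ∞) : ℝ≥0∞ :=
  if n = ⊤ then 0 else p ^ n.toNat

lemma rankWeight_top (p : ℝ≥0∞) : rankWeight p ⊤ = 0 := by simp [rankWeight]

lemma rankWeight_pos {p : ℝ≥0∞} (hp : 0 < p) {n : ℕ∞} (hn : n ≠ ⊤) : 0 < rankWeight p n := by
  rw [rankWeight, if_neg hn]
  exact ENNReal.pow_pos hp _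

lemma rankWeight_le_one {p : ℝ≥0∞} (hp : p ≤ 1) (n : ℕ∞) : rankWeight p n ≤ 1 := by
  unfold rankWeight
  split_ifs
  · exact zero_le
  · exact pow_le_one' hp _

lemma rankWeight_anti {p : ℝ≥0∞} (hp : p ≤ 1) {m n : ℕ∞} (hmn : m ≤ n) :
    rankWeight p n ≤ rankWeight p m := by
  by_cases hn : n = ⊤
  · simp [hn, rankWeight_top]
  · have hm : m ≠ ⊤ := ne_top_of_le_ne_top hn hmn
    rw [rankWeight, rankWeight, if_neg hn, if_neg hm]
    exact pow_le_pow_right_of_le_one' hp (ENat.toNat_le_toNat hmn hn)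

lemma rankWeight_add_one (p : ℝ≥0∞) (n : ℕ∞) :
    rankWeight p (n + 1) = p * rankWeight p n := by
  induction n using ENat.recTopCoe with
  | top => simp [rankWeight]
  | coe n =>
    have h : ((n : ℕ∞) + 1) = ((n + 1 : ℕ) : ℕ∞) := by push_cast; rfl
    rw [h, rankWeight, rankWeight, if_neg (ENat.natCast_ne_top _), if_neg (ENat.natCast_ne_top _),
      ENat.toNat_natCast, ENat.toNat_natCast, pow_succ']

/-- Along an action witnessing the rank condition, the rank weight does not decrease
in expectation. -/
lemma rankWeight_le_stepExp (M : MDP S A) {p : ℝ≥0∞} (hp1 : p ≤ 1)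
    (hp : ∀ s a, ∀ s' ∈ M.post s a, p ≤ M.prob s a s') {r : S → ℕ∞} {s : S} {a : A}
    (ha : a ∈ M.enabled s) (hr : M.rankBound r s a ≤ r s) :
    rankWeight p (r s) ≤ M.stepExp (fun s' => rankWeight p (r s')) s a := by
  classical
  obtain ⟨u, hu, hmin⟩ := (M.post s a).exists_min_image r (M.post_nonempty ha)
  have hinf : ⨅ s' ∈ M.post s a, r s' = r u :=
    le_antisymm (iInf₂_le u hu) (le_iInf₂ hmin)
  rw [rankBound, hinf] at hr
  refine (rankWeight_anti hp1 hr).trans ?_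
  -- If the ranks differ, the `+ 1` costs a factor `p`, which the successor `u` of minimal rank pays
  -- alone. Otherwise the weight is constant on the successors.
  split_ifs with hne
  · rw [rankWeight_add_one]
    calc p * rankWeight p (r u) ≤ M.prob s a u * rankWeight p (r u) := by
          gcongr
          exact hp s a u hu
      _ ≤ _ := Finset.single_le_sum
          (f := fun s' => (M.prob s a s' : ℝ≥0∞) * rankWeight p (r s'))
          (fun _ _ => zero_le) hu
  · push Not at hne
    rw [add_zero, M.stepExp_congr (h := fun _ => rankWeight p (r u))
      fun s' hs' => by rw [hne s' hs' u hu], M.stepExp_const ha]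

/-! ### The Markov chain induced by a strategy -/

section Chain

variable [MeasurableSpace S] [DiscreteMeasurableSpace S]

instance (M : MDP S A) (σ : M.Strategy) (s : S) : IsProbabilityMeasure (M.pathMeasure σ s) := by
  unfold pathMeasure; infer_instance

lemma lintegral_inducedStep (M : MDP S A) (σ : M.Strategy) (s : S) (h : S → ℝ≥0∞) :
    ∫⁻ s', h s' ∂(M.inducedStep σ s).toMeasure = M.stepExp h s (σ.1 s) := by
  rw [lintegral_fintype, stepExp_eq_sum_univ]
  refine Finset.sum_congr rfl fun s' _ => ?_
  rw [PMF.toMeasure_apply_singleton _ _ (MeasurableSet.singleton s'), mul_comm]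
  rfl

/-- Paths start in the initial state. -/
lemma ae_pathMeasure_zero (M : MDP S A) (σ : M.Strategy) (s : S) :
    ∀ᵐ ω ∂M.pathMeasure σ s, ω 0 = s := by
  have h := Kernel.traj_map_frestrictLe_apply (X := fun _ : ℕ => S) (κ := M.stepKernel σ) 0 0
    (fun _ => s)
  rw [Kernel.partialTraj_self, Kernel.id_apply] at h
  have hm : MeasurableSet {y : (_ : Finset.Iic 0) → S | y ⟨0, by simp⟩ = s} :=
    (measurable_pi_apply (X := fun _ : Finset.Iic 0 => S) ⟨0, by simp⟩)
      (MeasurableSet.singleton s)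
  have h2 : ∀ᵐ y ∂(M.pathMeasure σ s).map (Preorder.frestrictLe (π := fun _ : ℕ => S) 0),
      y ⟨0, by simp⟩ = s := by
    rw [pathMeasure, h, ae_dirac_iff hm]
  exact ae_of_ae_map (measurable_pi_lambda _ fun i => measurable_pi_apply _).aemeasurable h2

/-- The Markov property for one step, on paths that have avoided `T` so far. -/
lemma setLIntegral_avoid_succ (M : MDP S A) (σ : M.Strategy) (s : S) (T : Set S) (n : ℕ)
    (h : S → ℝ≥0∞) :
    ∫⁻ ω in avoid T n, h (ω (n + 1)) ∂M.pathMeasure σ s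
      = ∫⁻ ω in avoid T n, M.stepExp h (ω n) (σ.1 (ω n)) ∂M.pathMeasure σ s := by
  let B : Set ((_ : Finset.Iic n) → S) := {y | ∀ i, y i ∉ T}
  have hB : MeasurableSet B := by
    have : B = ⋂ i, (fun y : (_ : Finset.Iic n) → S => y i) ⁻¹' Tᶜ := by
      ext y; simp [B]
    rw [this]
    exact MeasurableSet.iInter fun i => measurable_pi_apply i MeasurableSet.of_discrete
  let R : (ℕ → S) → ((_ : Finset.Iic n) → S) := Preorder.frestrictLe (π := fun _ : ℕ => S) n
  have hR : Measurable R := measurable_pi_lambda _ fun i => measurable_pi_apply _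
  have hBR : avoid T n = R ⁻¹' B := by
    ext ω; simp [avoid, B, R]
  let last : Finset.Iic n := ⟨n, Finset.mem_Iic.2 le_rfl⟩
  let F : ((_ : Finset.Iic n) → S) × S → ℝ≥0∞ := fun q => B.indicator (fun _ => h q.2) q.1
  have hF : Measurable F := by
    have : F = (Prod.fst ⁻¹' B).indicator (fun q => h q.2) := by
      ext q
      by_cases hq : q.1 ∈ B
      · rw [Set.indicator_of_mem (s := Prod.fst ⁻¹' B) hq]
        exact Set.indicator_of_mem hq _
      · rw [Set.indicator_of_notMem (s := Prod.fst ⁻¹' B) hq]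
        exact Set.indicator_of_notMem hq _
    rw [this]
    exact ((Measurable.of_discrete (f := h)).comp measurable_snd).indicator (measurable_fst hB)
  -- The joint law of the history up to time `n` and the next state is the law of the history
  -- composed with the step kernel.
  have key := Kernel.partialTraj_compProd_eq_map_traj (X := fun _ : ℕ => S)
    (κ := M.stepKernel σ) (Nat.zero_le n) (x₀ := fun _ => s)
  have hmap := Kernel.traj_map_frestrictLe_apply (X := fun _ : ℕ => S) (κ := M.stepKernel σ) 0 n
    (fun _ => s)
  rw [← lintegral_indicator (measurableSet_avoid T n),
    ← lintegral_indicator (measurableSet_avoid T n)]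
  calc ∫⁻ ω, (avoid T n).indicator (fun ω => h (ω (n + 1))) ω ∂M.pathMeasure σ s
      = ∫⁻ ω, F (R ω, ω (n + 1)) ∂M.pathMeasure σ s := by
        refine lintegral_congr fun ω => ?_
        change _ = B.indicator (fun _ => h (ω (n + 1))) (R ω)
        rw [hBR]
        by_cases hω : R ω ∈ B
        · rw [Set.indicator_of_mem hω, Set.indicator_of_mem (s := R ⁻¹' B) hω]
        · rw [Set.indicator_of_notMem hω, Set.indicator_of_notMem (s := R ⁻¹' B) hω]
    _ = ∫⁻ q, F q ∂((M.pathMeasure σ s).map fun ω => (R ω, ω (n + 1))) :=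
        (lintegral_map hF (hR.prodMk (measurable_pi_apply _))).symm
    _ = ∫⁻ y, ∫⁻ s', F (y, s') ∂(M.stepKernel σ n y) ∂((M.pathMeasure σ s).map R) := by
        rw [← Measure.lintegral_compProd hF]
        congr 1
        exact key.symm.trans (by rw [← hmap]; rfl)
    _ = ∫⁻ y, B.indicator (fun y => M.stepExp h (y last) (σ.1 (y last))) y
          ∂((M.pathMeasure σ s).map R) := by
        refine lintegral_congr fun y => ?_
        by_cases hy : y ∈ B
        · simp only [F, Set.indicator_of_mem hy]
          exact M.lintegral_inducedStep σ (y last) h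
        · simp [F, Set.indicator_of_notMem hy]
    _ = ∫⁻ ω, B.indicator (fun y => M.stepExp h (y last) (σ.1 (y last))) (R ω)
          ∂M.pathMeasure σ s :=
        lintegral_map (((Measurable.of_discrete
          (f := fun t => M.stepExp h t (σ.1 t))).comp (measurable_pi_apply last)).indicator hB) hR
    _ = _ := by
        refine lintegral_congr fun ω => ?_
        rw [hBR]
        by_cases hω : R ω ∈ B
        · rw [Set.indicator_of_mem hω, Set.indicator_of_mem (s := R ⁻¹' B) hω]
          rfl
        · rw [Set.indicator_of_notMem hω, Set.indicator_of_notMem (s := R ⁻¹' B) hω]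

lemma setLIntegral_avoid_zero (M : MDP S A) (σ : M.Strategy) {s : S} {T : Set S} (hs : s ∉ T)
    (h : S → ℝ≥0∞) : ∫⁻ ω in avoid T 0, h (ω 0) ∂M.pathMeasure σ s = h s := by
  have h0 := M.ae_pathMeasure_zero σ s
  have hav : avoid T 0 =ᵐ[M.pathMeasure σ s] Set.univ := by
    filter_upwards [h0] with ω hω
    refine propext (iff_of_true (fun i hi => ?_) trivial)
    rwa [Nat.le_zero.1 hi, hω]
  rw [setLIntegral_congr hav, Measure.restrict_univ,
    lintegral_congr_ae (g := fun _ => h s) (h0.mono fun ω hω => by simp only [hω]),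
    lintegral_const, measure_univ, mul_one]

/-- A function vanishing on `T` may be evaluated at time `n + 1` on the paths avoiding `T` up to
time `n` instead of `n + 1`. -/
lemma setLIntegral_avoid_succ_of_eq_zero (M : MDP S A) (σ : M.Strategy) (s : S) {T : Set S}
    (n : ℕ) {h : S → ℝ≥0∞} (hT : ∀ t ∈ T, h t = 0) :
    ∫⁻ ω in avoid T (n + 1), h (ω (n + 1)) ∂M.pathMeasure σ s
      = ∫⁻ ω in avoid T n, M.stepExp h (ω n) (σ.1 (ω n)) ∂M.pathMeasure σ s := by
  rw [← setLIntegral_avoid_succ, ← lintegral_indicator (measurableSet_avoid T _),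
    ← lintegral_indicator (measurableSet_avoid T _)]
  refine lintegral_congr fun ω => ?_
  by_cases h1 : ω ∈ avoid T (n + 1)
  · rw [Set.indicator_of_mem h1, Set.indicator_of_mem (avoid_anti T n.le_succ h1)]
  · rw [Set.indicator_of_notMem h1]
    by_cases h0 : ω ∈ avoid T n
    · rw [Set.indicator_of_mem h0]
      -- A path that leaves the avoiding set exactly at time `n + 1` is then in `T`, where `h`
      -- vanishes.
      by_contra hne
      refine h1 fun i hi => ?_
      rcases Nat.le_succ_iff.1 hi with hi | rfl
      · exact h0 i hi
      · exact fun hmem => hne (hT _ hmem).symm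
    · rw [Set.indicator_of_notMem h0]

/-! ### Soundness for a fixed strategy -/

/-- If the expected reward is finite, then the target is reached almost surely. -/
lemma tendsto_measure_avoid (M : MDP S A) {T : Set S} {rew : S → ℝ≥0} {σ : M.Strategy} {s : S}
    (he : M.expReward T rew σ s ≠ ∞) :
    Tendsto (fun n => M.pathMeasure σ s (avoid T n)) atTop (𝓝 0) := by
  have hnull : M.pathMeasure σ s (⋂ n, avoid T n) = 0 := by
    by_contra hne
    refine he (top_le_iff.1 ?_)
    calc (∞ : ℝ≥0∞) = ∞ * M.pathMeasure σ s (⋂ n, avoid T n) := (ENNReal.top_mul hne).symm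
      _ = ∫⁻ ω, (⋂ n, avoid T n).indicator (fun _ => ∞) ω ∂M.pathMeasure σ s :=
        (lintegral_indicator_const (MeasurableSet.iInter (measurableSet_avoid T)) _).symm
      _ ≤ M.expReward T rew σ s := by
        refine lintegral_mono fun ω => ?_
        refine Set.indicator_le' (fun ω hω => ?_) (fun _ _ => zero_le) ω
        have hω' : ¬ ∃ i, ω i ∈ T := by
          rintro ⟨i, hi⟩
          exact Set.mem_iInter.1 hω i i le_rfl hi
        rw [pathReward, if_neg hω']
  rw [← hnull]
  exact tendsto_measure_iInter_atTop (fun n => (measurableSet_avoid T n).nullMeasurableSet)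
    (avoid_anti T) ⟨0, measure_ne_top _ _⟩

/-- If the target is reached almost surely, then no state of finite rank is visited before. -/
lemma ae_avoid_rank_eq_top (M : MDP S A) {T : Set S} {σ : M.Strategy} {r : S → ℕ∞} {s : S}
    (hT : ∀ t ∈ T, r t = ⊤) (hr : ∀ t, r t ≠ ⊤ → M.rankBound r t (σ.1 t) ≤ r t)
    (hlim : Tendsto (fun n => M.pathMeasure σ s (avoid T n)) atTop (𝓝 0)) (n : ℕ) :
    ∀ᵐ ω ∂(M.pathMeasure σ s).restrict (avoid T n), r (ω n) = ⊤ := by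
  obtain ⟨p, hp0, hp1, hp⟩ := M.exists_prob_lower_bound
  let f : S → ℝ≥0∞ := fun t => rankWeight p (r t)
  let I : ℕ → ℝ≥0∞ := fun n => ∫⁻ ω in avoid T n, f (ω n) ∂M.pathMeasure σ s
  -- The submartingale property; states of infinite rank have weight 0 and need no rank condition.
  have hmono : Monotone I := monotone_nat_of_le_succ fun n => by
    simp only [I]
    rw [M.setLIntegral_avoid_succ_of_eq_zero σ s n
      fun t ht => by simp only [f, hT t ht, rankWeight_top]]
    refine lintegral_mono fun ω => ?_
    by_cases hω : r (ω n) = ⊤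
    · simp [f, hω, rankWeight_top]
    · exact M.rankWeight_le_stepExp hp1 hp (σ.2 _) (hr _ hω)
  have hle : ∀ m, I m ≤ M.pathMeasure σ s (avoid T m) := fun m =>
    (lintegral_mono fun ω => rankWeight_le_one hp1 _).trans_eq (by simp)
  have hI : I n = 0 := le_antisymm
    (ge_of_tendsto hlim ((eventually_ge_atTop n).mono fun m hm => (hmono hm).trans (hle m)))
    zero_le
  have hae := (lintegral_eq_zero_iff (measurable_comp_eval f n)).1 hI
  filter_upwards [hae] with ω hω
  by_contra hne
  exact (rankWeight_pos hp0 hne).ne' hω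

/-- Soundness of lower bounds in the Markov chain induced by a strategy: it suffices that the rank
condition holds at states of finite rank and the value condition at states of infinite rank. -/
theorem le_expReward (M : MDP S A) {T : Set S} {rew : S → ℝ≥0} {σ : M.Strategy}
    {x : S → ℝ≥0∞} {r : S → ℕ∞} (hrT : ∀ t ∈ T, r t = ⊤) (hxT : ∀ t ∈ T, x t = 0)
    (hr : ∀ t, r t ≠ ⊤ → M.rankBound r t (σ.1 t) ≤ r t)
    (hx : ∀ t, r t = ⊤ → t ∉ T → x t ≤ rew t + M.stepExp x t (σ.1 t))
    (hfin : ∀ t, r t = ⊤ → x t ≠ ∞) (s : S) :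
    x s ≤ M.expReward T rew σ s := by
  classical
  by_cases he : M.expReward T rew σ s = ∞
  · simp [he]
  by_cases hs : s ∈ T
  · simp [hxT s hs]
  have hlim := M.tendsto_measure_avoid he
  have hrank := M.ae_avoid_rank_eq_top hrT hr hlim
  set μ := M.pathMeasure σ s
  have hunfold : ∀ n, x s ≤ (∑ k ∈ Finset.range n, ∫⁻ ω in avoid T k, (rew (ω k) : ℝ≥0∞) ∂μ)
      + ∫⁻ ω in avoid T n, x (ω n) ∂μ := by
    intro n
    induction n with
    | zero => simp [μ, M.setLIntegral_avoid_zero σ hs]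
    | succ n ih =>
      refine ih.trans ?_
      rw [Finset.sum_range_succ, add_assoc, M.setLIntegral_avoid_succ_of_eq_zero σ s n hxT,
        ← lintegral_add_left (measurable_comp_eval (fun t => (rew t : ℝ≥0∞)) n)]
      -- Almost every path still avoiding `T` is at a state of infinite rank, where `hx` applies.
      refine add_le_add le_rfl (lintegral_mono_ae ?_)
      filter_upwards [hrank n, ae_restrict_mem (measurableSet_avoid T n)] with ω h1 h2
      exact hx _ h1 (h2 n le_rfl)
  have hrew : ∀ n, ∑ k ∈ Finset.range n, ∫⁻ ω in avoid T k, (rew (ω k) : ℝ≥0∞) ∂μ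
      ≤ M.expReward T rew σ s := fun n => by
    have hm : ∀ k, Measurable ((avoid T k).indicator fun ω => (rew (ω k) : ℝ≥0∞)) := fun k =>
      (measurable_comp_eval (fun t => (rew t : ℝ≥0∞)) k).indicator (measurableSet_avoid T k)
    simp_rw [← lintegral_indicator (measurableSet_avoid T _)]
    rw [← lintegral_finsetSum _ fun k _ => hm k]
    exact lintegral_mono fun ω => sum_indicator_avoid_le_pathReward T rew ω n
  -- A finite bound for `x` on the states of infinite rank; elsewhere `x` may be `∞`.
  let C : ℝ≥0∞ := ∑ t, if r t = ⊤ then x t else 0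
  have hC : C ≠ ∞ := ENNReal.sum_ne_top.2 fun t _ => by
    split_ifs with ht
    · exact hfin t ht
    · exact ENNReal.zero_ne_top
  have htail : ∀ n, ∫⁻ ω in avoid T n, x (ω n) ∂μ ≤ C * μ (avoid T n) := fun n => by
    rw [← setLIntegral_const]
    refine lintegral_mono_ae ((hrank n).mono fun ω hω => ?_)
    have := Finset.single_le_sum (f := fun t => if r t = ⊤ then x t else 0)
      (fun _ _ => zero_le) (Finset.mem_univ (ω n))
    simpa only [if_pos hω] using this
  have hlimC : Tendsto (fun n => M.expReward T rew σ s + C * μ (avoid T n)) atTop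
      (𝓝 (M.expReward T rew σ s)) := by
    simpa using tendsto_const_nhds.add (ENNReal.Tendsto.const_mul hlim (Or.inr hC))
  exact ge_of_tendsto' hlimC fun n => (hunfold n).trans (add_le_add (hrew n) (htail n))

end Chain

end MDP

end

/-! ### From a fixed strategy to the optimum -/

theorem mainTheorem8 {S A : Type*} [Fintype S] [Fintype A]
    [MeasurableSpace S] [DiscreteMeasurableSpace S]
    (M : MDP S A) (T : Set S) (rew : S → ℝ≥0) (opt : Opt)
    (x : S → ℝ≥0∞) (r : S → ℕ∞) (h : M.IsLowerRewardCertificate T rew opt x r) :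
    ∀ s, x s ≤ M.optExpReward T rew opt s := by
  intro s
  have hrT : ∀ t ∈ T, r t = ⊤ := fun t ht => by
    simpa [MDP.compDist, ht] using h.rank t
  have hxT : ∀ t ∈ T, x t = 0 := fun t ht => by
    simpa [MDP.bellmanReward, ht] using h.value t
  have hfin : ∀ t, r t = ⊤ → x t ≠ ∞ := fun t ht hxt => (h.finite_rank t hxt).ne ht
  have hrank : ∀ t, r t ≠ ⊤ →
      (opt.dual.over fun a : M.enabled t => M.rankBound r t a) ≤ r t := fun t ht => by
    have := h.rank t
    rwa [MDP.compDist, if_neg fun hT => ht (hrT t hT)] at this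
  have hvalue : ∀ t, t ∉ T →
      x t ≤ rew t + opt.over fun a : M.enabled t => M.stepExp x t a := fun t ht => by
    have := h.value t
    rwa [MDP.bellmanReward, if_neg ht] at this
  cases opt with
  | min =>
    -- The dual of `min` is `max`, so every enabled action, hence every strategy, satisfies both
    -- conditions.
    refine le_iInf fun σ => M.le_expReward hrT hxT (fun t ht => ?_) (fun t _ htT => ?_) hfin s
    · exact (le_iSup (fun a : M.enabled t => M.rankBound r t a) ⟨σ.1 t, σ.2 t⟩).trans (hrank t ht)
    · exact (hvalue t htT).trans (add_le_add le_rfl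
        (iInf_le (fun a : M.enabled t => M.stepExp x t a) ⟨σ.1 t, σ.2 t⟩))
  | max =>
    -- Here the rank and value conditions may be witnessed by different actions: a rank minimizer is
    -- taken at finite rank, a value maximizer at infinite rank.
    have hchoice : ∀ t, ∃ a ∈ M.enabled t, (r t ≠ ⊤ → M.rankBound r t a ≤ r t) ∧
        (r t = ⊤ → t ∉ T → x t ≤ rew t + M.stepExp x t a) := fun t => by
      have : Nonempty (M.enabled t) := let ⟨a, ha⟩ := M.exists_enabled t; ⟨⟨a, ha⟩⟩
      by_cases ht : r t = ⊤
      · obtain ⟨a, ha⟩ := exists_eq_ciSup_of_finite (f := fun a : M.enabled t => M.stepExp x t a)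
        refine ⟨a, a.2, fun hne => absurd ht hne, fun _ htT => (hvalue t htT).trans_eq ?_⟩
        exact congrArg _ ha.symm
      · obtain ⟨a, ha⟩ := exists_eq_ciInf_of_finite (f := fun a : M.enabled t => M.rankBound r t a)
        exact ⟨a, a.2, fun hne => ha.trans_le (hrank t hne), fun htop => absurd htop ht⟩
    choose σ hσ hσr hσx using hchoice
    exact (M.le_expReward (σ := ⟨σ, hσ⟩) hrT hxT hσr hσx hfin s).trans
      (le_iSup (fun σ : M.Strategy => M.expReward T rew σ s) ⟨σ, hσ⟩)
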